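/- Let $G$ be a finite solvable group, let $p$ be a prime and let $P$ be a Sylow $p$-subgroup of $G$. Let $\mathrm{Irr}_m(G\mid 1_P)$ denote the set of irreducible complex characters $\chi$ of $G$ that are monomial (that is, $\chi=\lambda^G$ is induced from a linear character $\lambda$ of some subgroup of $G$) and that lie over the principal character $1_P$ of $P$ (that is, $1_P$ is a constituent of the restriction $\chi_P$). Then the following are equivalent: (i) $P$ is normal in $G$; (ii) $p$ does not divide $\chi(1)$ for every $\chi\in\mathrm{Irr}_m(G\mid 1_P)$; (iii) $\chi(x)\neq 0$ for every $\chi\in\mathrm{Irr}_m(G\mid 1_P)$ and every $x\in P$. -/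

import Mathlib

noncomputable section

namespace MonomialChar

/-- `χ ∈ Irr(G)`: `χ` is the character (trace function) of an irreducible finite-dimensional complex
representation of `G`. Up to isomorphism the underlying space is `ℂⁿ`. -/
def IsIrr {G : Type*} [Group G] (χ : G → ℂ) : Prop :=
  ∃ (n : ℕ) (ρ : Representation ℂ G (Fin n → ℂ)), ρ.IsIrreducible ∧ χ = ρ.character

open Classical in
/-- The character of `G` induced from a linear character `lam` of a subgroup `H` of the finite
group `G`: its value at `g` is `|H|⁻¹ ∑_{x ∈ G} lam°(x⁻¹ g x)`, where `lam°` agrees with `lam` on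
`H` and is `0` outside `H`. -/
def inducedChar {G : Type*} [Group G] [Finite G] (H : Subgroup G) (lam : H →* ℂˣ) : G → ℂ :=
  fun g => (Nat.card H : ℂ)⁻¹ *
    ∑ᶠ x : G, if h : x⁻¹ * g * x ∈ H then ((lam ⟨x⁻¹ * g * x, h⟩ : ℂˣ) : ℂ) else 0

/-- `χ` is monomial: it is induced from a linear character of some subgroup. -/
def IsMonomial {G : Type*} [Group G] [Finite G] (χ : G → ℂ) : Prop :=
  ∃ (H : Subgroup G) (lam : H →* ℂˣ), χ = inducedChar H lam

/-- The usual inner product `|G|⁻¹ ∑_{g ∈ G} α(g) conj(β(g))` of complex functions on `G`. -/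
def charInner {G : Type*} [Group G] [Finite G] (α β : G → ℂ) : ℂ :=
  (Nat.card G : ℂ)⁻¹ * ∑ᶠ g : G, α g * starRingEnd ℂ (β g)

/-- For a character `χ` of `G` and an irreducible character `θ` of a subgroup `H`: `χ` lies over
`θ`, i.e. `θ` is a constituent of the restriction of `χ` to `H`. -/
def LiesOver {G : Type*} [Group G] [Finite G] (χ : G → ℂ) {H : Subgroup G} (θ : H → ℂ) : Prop :=
  charInner (fun h : H => χ h) θ ≠ 0

/-- The principal character `1_H` of a subgroup `H`. -/
def principalChar {G : Type*} [Group G] (H : Subgroup G) : H → ℂ := fun _ => 1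

/-- `Irr_m(G | 1_H)`: the irreducible monomial characters of `G` lying over the principal
character of `H`. -/
def irrMonomialOverPrincipal {G : Type*} [Group G] [Finite G] (H : Subgroup G) : Set (G → ℂ) :=
  {χ | IsIrr χ ∧ IsMonomial χ ∧ LiesOver χ (principalChar H)}

end MonomialChar

end

namespace MonomialChar

/-! If `P` is normal, the `P`-fixed vectors of an irreducible representation over `1_P` form a
nonzero invariant subspace, hence everything. So `χ(x) = χ(1) ≠ 0` on `P`. If moreover `χ` is
induced from `T`, then `P ≤ T`, so `χ(1) = |G : T|` divides `|G : P|`.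

If `P` is not normal, one character violates both (ii) and (iii): an irreducible `λ^G` over `1_P`,
with `λ` on `T`, such that some `z ∈ P` has no conjugate in `T`. Then `λ^G(z) = 0`, and `p` divides
`|G : T|` because `T` contains no Sylow `p`-subgroup of `G`.

To construct it, pass to quotients until `PM` is normal for every normal `M ≠ 1`. The Frattini
argument then gives `G = M N_G(P)`. For an abelian normal `N ≠ 1`, `N_G(P)` is a complement, and
`Z(P)` acts faithfully and coprimely on `N`. Some linear character of `N` therefore has trivial
stabilizer in `Z(P)`. It extends to its inertia group `T`, trivially on `T ∩ N_G(P)`, and no `1 ≠ z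
∈ Z(P)` has a conjugate in `T`. -/

theorem isIrr_of_forall_submodule {G V : Type*} [Group G] [AddCommGroup V] [Module ℂ V]
    [FiniteDimensional ℂ V] [Nontrivial V] (ρ : Representation ℂ G V)
    (h : ∀ W : Submodule ℂ V, (∀ g, ∀ v ∈ W, ρ g v ∈ W) → W ≠ ⊥ → W = ⊤) :
    IsIrr ρ.character := by
  let e : V ≃ₗ[ℂ] (Fin (Module.finrank ℂ V) → ℂ) :=
    LinearEquiv.ofFinrankEq _ _ (by simp)
  let σ : Representation ℂ G (Fin (Module.finrank ℂ V) → ℂ) :=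
    { toFun := fun g => e.conj (ρ g)
      map_one' := by ext1; simp [Module.End.one_eq_id]
      map_mul' := fun a b => by rw [map_mul, Module.End.mul_eq_comp, LinearEquiv.conj_comp]; rfl }
  have hσ : ∀ g v, σ g (e v) = e (ρ g v) := fun g v => by simp [σ, LinearEquiv.conj_apply]
  have key : ∀ S : Subrepresentation σ, S ≠ ⊥ → S = ⊤ := by
    intro S hS
    apply Subrepresentation.toSubmodule_injective
    have := h (S.toSubmodule.comap e.toLinearMap)
      (fun g v hv => by
        have := S.apply_mem_toSubmodule g hv
        simpa [hσ] using this)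
      (fun hb => hS (Subrepresentation.toSubmodule_injective ?_))
    · change S.toSubmodule = ⊤
      rw [eq_top_iff] at this ⊢
      intro w _
      have := this (Submodule.mem_top (x := e.symm w))
      simpa using this
    · change S.toSubmodule = ⊥
      rw [eq_bot_iff] at hb ⊢
      intro w hw
      have : e.symm w ∈ S.toSubmodule.comap e.toLinearMap := by simpa using hw
      simpa using hb this
  refine ⟨_, σ, ?_, ?_⟩
  · have : Nontrivial (Subrepresentation σ) := by
      refine ⟨⊥, ⊤, fun hbt => ?_⟩
      have h2 : (⊥ : Submodule ℂ (Fin (Module.finrank ℂ V) → ℂ)) = ⊤ :=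
        congrArg Subrepresentation.toSubmodule hbt
      obtain ⟨v, hv⟩ := exists_ne (0 : V)
      have : e v ∈ (⊥ : Submodule ℂ (Fin (Module.finrank ℂ V) → ℂ)) := h2 ▸ Submodule.mem_top
      exact hv (by simpa using this)
    exact { eq_bot_or_eq_top := fun S => or_iff_not_imp_left.2 (key S) }
  · funext g
    exact (LinearMap.trace_conj' (ρ g) e).symm

/-! ### Characters induced from linear characters -/

section Induced

variable {G : Type*} [Group G] (H : Subgroup G) (lam : H →* ℂˣ)

open Classical in
/-- The extension by zero of a linear character of a subgroup. -/
noncomputable def zeroExt (g : G) : ℂ := if h : g ∈ H then ((lam ⟨g, h⟩ : ℂˣ) : ℂ) else 0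

variable {H}

theorem zeroExt_of_mem {g : G} (h : g ∈ H) : zeroExt H lam g = lam ⟨g, h⟩ := dif_pos h

theorem zeroExt_coe (t : H) : zeroExt H lam t = lam t := dif_pos t.2

theorem zeroExt_of_notMem {g : G} (h : g ∉ H) : zeroExt H lam g = 0 := dif_neg h

theorem zeroExt_coe_mul (g : G) (t : H) : zeroExt H lam (t * g) = lam t * zeroExt H lam g := by
  by_cases h : g ∈ H
  · rw [zeroExt_of_mem lam h, zeroExt_of_mem lam (mul_mem t.2 h), ← Units.val_mul, ← map_mul]
    rfl
  · rw [zeroExt_of_notMem lam h, zeroExt_of_notMem lam, mul_zero]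
    rwa [Subgroup.mul_mem_cancel_left H t.2]

theorem zeroExt_one : zeroExt H lam 1 = 1 := by
  simpa using zeroExt_coe lam 1

/-- Orthogonality: a linear character of the preimage of `H` sums to its order or to `0`. This makes
every Mackey term of an inner product with `1_P` nonnegative. -/
theorem exists_sum_zeroExt_comp_eq_natCast {K : Type*} [Group K] [Fintype K] (f : K →* G) :
    ∃ k : ℕ, ∑ x : K, zeroExt H lam (f x) = k := by
  classical
  let μ : H.comap f →* ℂ := (Units.coeHom ℂ).comp (lam.comp (f.subgroupComap H))
  have h1 : ∑ x : K, zeroExt H lam (f x) = ∑ x : H.comap f, μ x := by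
    have h2 : ∀ x : H.comap f, μ x = zeroExt H lam (f x) := fun x =>
      (zeroExt_of_mem lam x.2).symm
    simp only [h2]
    rw [← Finset.sum_subtype {x | x ∈ H.comap f} (by simp) fun x => zeroExt H lam (f x)]
    refine (Finset.sum_subset (Finset.subset_univ _) fun x _ hx => ?_).symm
    exact zeroExt_of_notMem lam (by simpa using hx)
  rw [h1, sum_hom_units]
  split_ifs
  · exact ⟨_, rfl⟩
  · exact ⟨0, by simp⟩

theorem norm_zeroExt_le [Finite G] (g : G) : ‖zeroExt H lam g‖ ≤ 1 := by
  by_cases h : g ∈ H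
  · rw [zeroExt_of_mem lam h]
    refine (Complex.norm_eq_one_of_pow_eq_one (n := Nat.card H) ?_ Nat.card_pos.ne').le
    rw [← Units.val_pow_eq_pow_val, ← map_pow, pow_card_eq_one', map_one, Units.val_one]
  · rw [zeroExt_of_notMem lam h]; simp

theorem inducedChar_eq [Fintype G] (g : G) :
    inducedChar H lam g = (Nat.card H : ℂ)⁻¹ * ∑ x : G, zeroExt H lam (x⁻¹ * g * x) := by
  rw [inducedChar, finsum_eq_sum_of_fintype]
  rfl

theorem inducedChar_one [Finite G] : inducedChar H lam 1 = H.index := by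
  have := Fintype.ofFinite G
  rw [inducedChar_eq]
  simp only [mul_one, inv_mul_cancel, zeroExt_one, Finset.sum_const, Finset.card_univ, nsmul_eq_mul]
  rw [← Nat.card_eq_fintype_card, ← H.card_mul_index, Nat.cast_mul, inv_mul_cancel_left₀]
  exact_mod_cast Nat.card_pos.ne'

variable (H) in
/-- The functions on `G` which transform under right translation by `H` through the inverse
of `lam`: the space of the induced representation. -/
def inducedSpace : Submodule ℂ (G → ℂ) where
  carrier := {f | ∀ (g : G) (t : H), f (g * t) * lam t = f g}
  add_mem' {a b} ha hb g t := by simp [add_mul, ha g t, hb g t]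
  zero_mem' := by simp
  smul_mem' c a ha g t := by simp [mul_assoc, ha g t]

variable (G) in
/-- Left translation of functions on `G`. -/
def leftTranslation : Representation ℂ G (G → ℂ) where
  toFun g := LinearMap.funLeft ℂ ℂ (fun x => g⁻¹ * x)
  map_one' := by ext; simp [LinearMap.funLeft]
  map_mul' a b := by ext; simp [LinearMap.funLeft, mul_assoc]

theorem leftTranslation_apply (g x : G) (f : G → ℂ) : leftTranslation G g f x = f (g⁻¹ * x) := rfl

variable (H) in
/-- The induced representation of a linear character. -/
def inducedRep : Representation ℂ G (inducedSpace H lam) :=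
  Subrepresentation.toRepresentation (ρ := leftTranslation G)
    ⟨inducedSpace H lam, fun g f hf x t => by
      rw [leftTranslation_apply, leftTranslation_apply, ← mul_assoc, hf]⟩

theorem inducedRep_apply (g x : G) (f : inducedSpace H lam) :
    (inducedRep H lam g f : G → ℂ) x = (f : G → ℂ) (g⁻¹ * x) := rfl

variable (H) in
/-- The projection of all functions onto the space of the induced representation. -/
noncomputable def inducedProj [Fintype H] : (G → ℂ) →ₗ[ℂ] inducedSpace H lam where
  toFun f := ⟨fun g => (Nat.card H : ℂ)⁻¹ * ∑ t : H, f (g * t) * lam t, fun g s => by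
    change _ = (Nat.card H : ℂ)⁻¹ * ∑ t : H, f (g * t) * (lam t : ℂ)
    rw [mul_assoc, Finset.sum_mul, ← Equiv.sum_comp (Equiv.mulLeft s) fun t : H => f (g * t) * (lam t : ℂ)]
    refine congrArg _ (Finset.sum_congr rfl fun t _ => ?_)
    simp only [Equiv.coe_mulLeft, Subgroup.coe_mul, map_mul, Units.val_mul, mul_assoc]
    rw [mul_comm (lam s : ℂ)]⟩
  map_add' a b := by
    ext g; simp [add_mul, Finset.sum_add_distrib, mul_add]
  map_smul' c a := by
    ext g; simp [mul_assoc, ← Finset.mul_sum, mul_left_comm]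

theorem inducedProj_coe [Fintype H] (f : inducedSpace H lam) : inducedProj H lam f = f := by
  ext g
  change (Nat.card H : ℂ)⁻¹ * ∑ t : H, (f : G → ℂ) (g * t) * lam t = _
  simp only [f.2 g, Finset.sum_const, Finset.card_univ, nsmul_eq_mul]
  rw [← Nat.card_eq_fintype_card, inv_mul_cancel_left₀]
  exact_mod_cast Nat.card_pos.ne'

theorem character_inducedRep [Finite G] : (inducedRep H lam).character = inducedChar H lam := by
  classical
  have := Fintype.ofFinite G
  funext g
  -- Cyclicity of the trace moves the computation to all functions on `G`, where the delta functions
  -- form a basis.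
  have h1 : (inducedRep H lam g) =
      inducedProj H lam ∘ₗ ((inducedSpace H lam).subtype ∘ₗ inducedRep H lam g) := by
    ext1 f
    exact (inducedProj_coe lam (inducedRep H lam g f)).symm
  rw [Representation.character, h1, LinearMap.trace_comp_comm',
    LinearMap.trace_eq_matrix_trace ℂ (Pi.basisFun ℂ G), Matrix.trace, inducedChar_eq,
    Finset.mul_sum]
  refine Finset.sum_congr rfl fun x _ => ?_
  rw [Matrix.diag_apply, LinearMap.toMatrix_apply]
  change (Nat.card H : ℂ)⁻¹ * ∑ t : H, (Pi.basisFun ℂ G x) (g⁻¹ * x * t) * lam t = _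
  congr 1
  by_cases h : x⁻¹ * g * x ∈ H
  · rw [zeroExt_of_mem lam h, Finset.sum_eq_single ⟨_, h⟩]
    · simp [mul_assoc]
    · intro t _ ht
      rw [Pi.basisFun_apply, Pi.single_eq_of_ne, zero_mul]
      rintro h2
      apply ht
      ext
      change (t : G) = x⁻¹ * g * x
      calc (t : G) = x⁻¹ * g * (g⁻¹ * x * t) := by group
        _ = x⁻¹ * g * x := by rw [h2]
    · simp
  · rw [zeroExt_of_notMem lam h]
    refine Finset.sum_eq_zero fun t _ => ?_
    rw [Pi.basisFun_apply, Pi.single_eq_of_ne, zero_mul]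
    rintro h2
    have : (t : G) = x⁻¹ * g * x := by
      calc (t : G) = x⁻¹ * g * (g⁻¹ * x * t) := by group
        _ = x⁻¹ * g * x := by rw [h2]
    exact h (this ▸ t.2)

/-- Clifford's criterion for the irreducibility of an induced linear character. -/
theorem isIrr_inducedChar [Finite G] (N : Subgroup G) [hN : N.Normal] (hNH : N ≤ H)
    (hlam : ∀ g ∉ H, ∃ n : N, zeroExt H lam (g⁻¹ * n * g) ≠ zeroExt H lam n) :
    IsIrr (inducedChar H lam) := by
  classical
  have := Fintype.ofFinite G
  rw [← character_inducedRep]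
  have hδmem : (fun x => zeroExt H lam x⁻¹) ∈ inducedSpace H lam := by
    intro g t
    have := zeroExt_coe_mul lam ((t : G)⁻¹ * g⁻¹) t
    rw [mul_inv_cancel_left] at this
    change zeroExt H lam (g * t)⁻¹ * lam t = zeroExt H lam g⁻¹
    rw [this, mul_inv_rev, mul_comm]
  let δ : inducedSpace H lam := ⟨_, hδmem⟩
  have hδ : ∀ x, (δ : G → ℂ) x = zeroExt H lam x⁻¹ := fun _ => rfl
  have hδ1 : (δ : G → ℂ) 1 = 1 := by rw [hδ, inv_one, zeroExt_one]
  have : Nontrivial (inducedSpace H lam) := ⟨δ, 0, fun h => by simp [h] at hδ1⟩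
  refine isIrr_of_forall_submodule _ fun W hW hW0 => ?_
  -- Averaging over `N` against `lam⁻¹` kills the values of `f'` off `H`, where the conjugate of
  -- `lam` differs from `lam` on `N`; a nonzero multiple of `δ` remains.
  have hδW : δ ∈ W := by
    obtain ⟨f, hfW, hf0⟩ := W.exists_mem_ne_zero_of_ne_bot hW0
    obtain ⟨x, hx⟩ : ∃ x, (f : G → ℂ) x ≠ 0 := by
      by_contra! h
      exact hf0 (Subtype.ext (funext h))
    obtain ⟨f', hf'W, hf'1⟩ : ∃ f' ∈ W, (f' : G → ℂ) 1 ≠ 0 :=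
      ⟨_, hW x⁻¹ f hfW, by simpa [inducedRep_apply] using hx⟩
    let r : N →* H := Subgroup.inclusion hNH
    have hr : ∀ n : N, (r n : G) = n := fun _ => rfl
    let c : G → N →* ℂ := fun g =>
      (Units.coeHom ℂ).comp ((lam.comp (r.comp (MulAut.conjNormal g⁻¹).toMonoidHom)) / (lam.comp r))
    have hc : ∀ g (n : N), c g n * lam (r n) = zeroExt H lam (g⁻¹ * n * g) := by
      intro g n
      have : g⁻¹ * n * g = r (MulAut.conjNormal g⁻¹ n) := by rw [hr]; simp
      rw [this, zeroExt_coe]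
      simp [c]
    have hcz : ∀ g ∉ H, ∑ n, c g n = 0 := by
      intro g hg
      obtain ⟨n, hn⟩ := hlam g hg
      refine sum_hom_units_eq_zero _ fun h1 => hn ?_
      rw [← hc, h1, ← hr, zeroExt_coe]
      simp
    have hch : ∀ h : H, ∑ n, c h n = Nat.card N := by
      intro h
      have : ∀ n, c h n = 1 := fun n => by
        have h1 := hc h n
        rw [← hr, ← Subgroup.coe_inv, ← Subgroup.coe_mul, ← Subgroup.coe_mul, zeroExt_coe] at h1
        simpa [mul_comm] using h1
      simp [this]
    have hsum : ∑ n : N, ((lam (r n))⁻¹ : ℂˣ).1 • inducedRep H lam (n : G) f' =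
        ((Nat.card N : ℂ) * (f' : G → ℂ) 1) • δ := by
      ext g
      have h1 : ∀ n : N, ((lam (r n))⁻¹ : ℂˣ).1 * (f' : G → ℂ) ((n : G)⁻¹ * g) =
          c g n * (f' : G → ℂ) g := by
        intro n
        have h2 := f'.2 ((n : G)⁻¹ * g) (r (MulAut.conjNormal g⁻¹ n))
        have h3 : (n : G)⁻¹ * g * (r (MulAut.conjNormal g⁻¹ n)) = g := by rw [hr]; simp [mul_assoc]
        rw [h3] at h2
        rw [← h2]
        simp only [c, MonoidHom.coe_comp, Function.comp_apply, MonoidHom.div_apply,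
          Units.coeHom_apply, div_eq_mul_inv, Units.val_mul, MulEquiv.toMonoidHom_eq_coe,
          MonoidHom.coe_coe]
        ring
      have h2 : ((∑ n : N, ((lam (r n))⁻¹ : ℂˣ).1 • inducedRep H lam (n : G) f' :
          inducedSpace H lam) : G → ℂ) g = (∑ n, c g n) * (f' : G → ℂ) g := by
        rw [Finset.sum_mul, AddSubmonoidClass.coe_finsetSum, Finset.sum_apply]
        exact Finset.sum_congr rfl fun n _ => h1 n
      rw [h2]
      change _ = (Nat.card N : ℂ) * (f' : G → ℂ) 1 * (zeroExt H lam g⁻¹)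
      by_cases hg : g ∈ H
      · rw [hch ⟨g, hg⟩, mul_assoc]
        congr 1
        have := f'.2 1 ⟨g, hg⟩
        rw [one_mul] at this
        rw [← this, mul_assoc]
        have h3 := zeroExt_coe lam (⟨g, hg⟩ : H)⁻¹
        rw [Subgroup.coe_inv] at h3
        rw [h3]
        simp
      · rw [hcz g hg, zeroExt_of_notMem lam (by simpa using hg)]
        simp
    have h2 : ((Nat.card N : ℂ) * (f' : G → ℂ) 1) • δ ∈ W := by
      rw [← hsum]
      exact W.sum_mem fun n _ => W.smul_mem _ (hW _ _ hf'W)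
    rwa [W.smul_mem_iff (mul_ne_zero (by exact_mod_cast Nat.card_pos.ne') hf'1)] at h2
  rw [eq_top_iff]
  rintro f -
  -- The translates of `δ` span the induced space.
  have hsum : ∑ x : G, (f : G → ℂ) x • inducedRep H lam x δ = (Nat.card H : ℂ) • f := by
    ext g
    have h1 : ∀ y, (f : G → ℂ) (g * y) * zeroExt H lam y =
        if y ∈ H then (f : G → ℂ) g else 0 := by
      intro y
      split_ifs with hy
      · rw [zeroExt_of_mem lam hy]; exact f.2 g ⟨y, hy⟩
      · rw [zeroExt_of_notMem lam hy, mul_zero]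
    rw [AddSubmonoidClass.coe_finsetSum, Finset.sum_apply]
    calc _ = ∑ x, (f : G → ℂ) x * zeroExt H lam (g⁻¹ * x) := by
            refine Finset.sum_congr rfl fun x _ => ?_
            change _ * zeroExt H lam (x⁻¹ * g)⁻¹ = _
            simp
      _ = ∑ y, (f : G → ℂ) (g * y) * zeroExt H lam y := by
            rw [← Equiv.sum_comp (Equiv.mulLeft g)]; simp
      _ = _ := by
            simp only [h1]
            rw [← Finset.sum_filter, Finset.sum_const, nsmul_eq_mul, ← Fintype.card_subtype,
              ← Nat.card_eq_fintype_card]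
            rfl
  have h2 : (Nat.card H : ℂ) • f ∈ W := by
    rw [← hsum]
    exact W.sum_mem fun n _ => W.smul_mem _ (hW _ _ hδW)
  rwa [W.smul_mem_iff (by exact_mod_cast Nat.card_pos.ne')] at h2

/-- Up to a positive factor the inner product is a sum of natural numbers over `x : G`, and the term
at `x = 1` is `|P ∩ H|`. -/
theorem liesOver_inducedChar [Finite G] (P : Subgroup G)
    (hP : ∀ t : H, (t : G) ∈ P → lam t = 1) :
    LiesOver (inducedChar H lam) (principalChar P) := by
  classical
  have := Fintype.ofFinite G
  have h1 : charInner (fun h : P => inducedChar H lam h) (principalChar P) =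
    ((Nat.card P : ℂ)⁻¹ * (Nat.card H : ℂ)⁻¹) * ∑ x : G, ∑ g : P, zeroExt H lam (x⁻¹ * g * x) := by
    rw [charInner, finsum_eq_sum_of_fintype, Finset.sum_comm, mul_assoc]
    simp only [principalChar, inducedChar_eq, map_one, mul_one, Finset.mul_sum]
  have h2 : ∀ x : G, ∃ k : ℕ, ∑ g : P, zeroExt H lam (x⁻¹ * g * x) = k := by
    intro x
    obtain ⟨k, hk⟩ := exists_sum_zeroExt_comp_eq_natCast lam
      ((MulAut.conj x⁻¹).toMonoidHom.comp P.subtype)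
    exact ⟨k, by simpa using hk⟩
  have h3 : ∑ g : P, zeroExt H lam (1⁻¹ * g * 1) = Nat.card {g : P // (g : G) ∈ H} := by
    rw [Nat.card_eq_fintype_card, Fintype.card_subtype, Finset.card_filter]
    push_cast
    refine Finset.sum_congr rfl fun g _ => ?_
    rw [inv_one, one_mul, mul_one]
    split_ifs with hg
    · rw [zeroExt_of_mem lam hg, hP ⟨g, hg⟩ g.2]; simp
    · exact zeroExt_of_notMem lam hg
  choose k hk using h2
  have hk1 : k 1 ≠ 0 := by
    have : k 1 = Nat.card {g : P // (g : G) ∈ H} := by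
      have := hk 1
      rw [h3] at this
      exact_mod_cast this.symm
    rw [this]
    have : Nonempty {g : P // (g : G) ∈ H} := ⟨1, by simp⟩
    exact Nat.card_pos.ne'
  rw [LiesOver, h1]
  refine mul_ne_zero (mul_ne_zero ?_ ?_) ?_
  · exact inv_ne_zero (by exact_mod_cast Nat.card_pos.ne')
  · exact inv_ne_zero (by exact_mod_cast Nat.card_pos.ne')
  · simp only [hk]
    rw [← Nat.cast_sum, Nat.cast_ne_zero]
    intro h
    exact hk1 (Finset.sum_eq_zero_iff.1 h 1 (Finset.mem_univ _))

theorem inducedChar_eq_zero [Finite G] {g : G} (hg : ∀ x, x⁻¹ * g * x ∉ H) :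
    inducedChar H lam g = 0 := by
  have := Fintype.ofFinite G
  rw [inducedChar_eq, Finset.sum_eq_zero fun x _ => zeroExt_of_notMem lam (hg x), mul_zero]

/-- Equality in the triangle inequality leaves no room for a vanishing summand. -/
theorem conj_mem_of_inducedChar_eq [Finite G] {g : G}
    (hg : inducedChar H lam g = inducedChar H lam 1) (x : G) : x⁻¹ * g * x ∈ H := by
  have := Fintype.ofFinite G
  have hc : (Nat.card H : ℂ)⁻¹ ≠ 0 := inv_ne_zero (by exact_mod_cast Nat.card_pos.ne')
  rw [inducedChar_eq, inducedChar_eq] at hg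
  have h1 := mul_left_cancel₀ hc hg
  simp only [mul_one, inv_mul_cancel, zeroExt_one] at h1
  by_contra hx
  have h2 : ∑ y : G, ‖zeroExt H lam (y⁻¹ * g * y)‖ < ∑ y : G, (1 : ℝ) :=
    Finset.sum_lt_sum (fun y _ => norm_zeroExt_le lam _)
      ⟨x, Finset.mem_univ _, by rw [zeroExt_of_notMem lam hx]; simp⟩
  have h3 := norm_sum_le Finset.univ fun y : G => zeroExt H lam (y⁻¹ * g * y)
  rw [h1] at h3
  simp at h3 h2
  linarith

end Induced

theorem apply_eq_apply_one_of_liesOver {G : Type*} [Group G] [Finite G] (P : Subgroup G)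
    [hP : P.Normal] {χ : G → ℂ} (hχ : IsIrr χ) (h : LiesOver χ (principalChar P)) :
    χ 1 ≠ 0 ∧ ∀ x ∈ P, χ x = χ 1 := by
  obtain ⟨n, ρ, hρ, rfl⟩ := hχ
  have := Fintype.ofFinite P
  let S : Subrepresentation ρ :=
    { toSubmodule := ⨅ x : P, LinearMap.ker (ρ x - 1)
      apply_mem_toSubmodule := by
        intro g v hv
        simp only [Submodule.mem_iInf, LinearMap.mem_ker, LinearMap.sub_apply, Module.End.one_apply,
          sub_eq_zero] at hv ⊢
        intro x
        have h1 := hv ⟨g⁻¹ * x * g, by simpa using hP.conj_mem x x.2 g⁻¹⟩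
        calc ρ x (ρ g v) = ρ g (ρ (g⁻¹ * x * g) v) := by
              rw [← Module.End.mul_apply, ← Module.End.mul_apply, ← map_mul, ← map_mul]
              congr 2; group
          _ = ρ g v := by rw [h1] }
  have hS : ∀ v, v ∈ S.toSubmodule ↔ ∀ x : P, ρ x v = v := by
    intro v
    simp [S, Submodule.mem_iInf, sub_eq_zero]
  have hne : S ≠ ⊥ := by
    intro hb
    apply h
    have h0 : ∑ x : P, ρ x = 0 := by
      refine LinearMap.ext fun v => ?_
      have hv : (∑ x : P, ρ x) v ∈ S.toSubmodule := by
        rw [hS]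
        intro y
        rw [← Module.End.mul_apply, Finset.mul_sum]
        simp only [← map_mul, ← Subgroup.coe_mul]
        exact congrArg (fun F => F v) (Equiv.sum_comp (Equiv.mulLeft y) fun x : P => ρ x)
      rw [hb] at hv
      exact hv
    rw [charInner, finsum_eq_sum_of_fintype]
    simp only [principalChar, map_one, mul_one, Representation.character]
    rw [← map_sum, h0, map_zero, mul_zero]
  have htop : S = ⊤ := (hρ.eq_bot_or_eq_top S).resolve_left hne
  have hone : ∀ x ∈ P, ρ x = 1 := by
    intro x hx
    refine LinearMap.ext fun v => ?_
    have : v ∈ S.toSubmodule := by rw [htop]; exact Submodule.mem_top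
    exact (hS v).1 this ⟨x, hx⟩
  refine ⟨?_, fun x hx => by simp [Representation.character, hone x hx]⟩
  rw [Representation.char_one]
  simp only [Module.finrank_fintype_fun_eq_card, Fintype.card_fin, ne_eq, Nat.cast_eq_zero]
  rintro rfl
  apply hne
  apply Subrepresentation.toSubmodule_injective
  exact Subsingleton.elim _ _

/-! ### Regular orbits of coprime abelian actions -/

/-- A finite abelian group acting faithfully and coprimely on a finite abelian group has a
regular orbit. -/
theorem exists_forall_apply_eq_imp_eq_one {A V : Type*} [CommGroup A] [CommGroup V] [Finite A]
    [Finite V] (φ : A →* MulAut V) (hφ : Function.Injective φ)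
    (hco : (Nat.card A).Coprime (Nat.card V)) : ∃ v, ∀ a, φ a v = v → a = 1 := by
  classical
  have := Fintype.ofFinite A
  let stab : V → Subgroup A := fun v =>
    { carrier := {a | φ a v = v}
      one_mem' := by simp
      mul_mem' := fun {a b} ha hb => by
        simp only [Set.mem_ofPred_eq] at ha hb ⊢
        rw [map_mul, MulAut.mul_apply, hb, ha]
      inv_mem' := fun {a} ha => by
        simp only [Set.mem_ofPred_eq] at ha ⊢
        rw [map_inv, MulAut.inv_apply, MulEquiv.symm_apply_eq, ha] }
  have hstab : ∀ v a, a ∈ stab v ↔ φ a v = v := fun _ _ => Iff.rfl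
  -- A point with smallest stabilizer is regular: otherwise it is multiplied by some `μ ≠ 1` of norm
  -- `1` over `stab v`, and minimality is contradicted. By coprimality (`hfix`), only `1` is both
  -- fixed by `stab v` and of norm `1`.
  obtain ⟨v, hv⟩ := Finite.exists_min fun v => Nat.card (stab v)
  refine ⟨v, fun a ha => ?_⟩
  by_contra ha1
  obtain ⟨w, hw⟩ : ∃ w, φ a w ≠ w := by
    by_contra! h
    exact ha1 (hφ (by ext w; simp [h w]))
  let nm : V →* V := ∏ c : stab v, (φ c).toMonoidHom
  have hnm : ∀ u, nm u = ∏ c : stab v, φ c u := fun u => by simp [nm]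
  have hfix : ∀ u, (∀ c ∈ stab v, φ c u = u) → nm u = 1 → u = 1 := by
    intro u hu h1
    rw [hnm, Finset.prod_congr rfl fun (c : stab v) _ => hu c c.2, Finset.prod_const, Finset.card_univ,
      ← Nat.card_eq_fintype_card] at h1
    have hc : (Nat.card (stab v)).Coprime (Nat.card V) :=
      Nat.Coprime.coprime_dvd_left (Subgroup.card_subgroup_dvd_card _) hco
    rw [← orderOf_dvd_iff_pow_eq_one] at h1
    exact orderOf_eq_one_iff.1 (Nat.eq_one_of_dvd_coprimes hc h1 (orderOf_dvd_natCard u))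
  have hcomm : ∀ b c u, φ b (φ c u) = φ c (φ b u) := fun b c u => by
    rw [← MulAut.mul_apply, ← map_mul, mul_comm, map_mul, MulAut.mul_apply]
  have hnmφ : ∀ b u, nm (φ b u) = φ b (nm u) := fun b u => by
    rw [hnm, hnm, map_prod]
    exact Finset.prod_congr rfl fun c _ => hcomm _ _ _
  have hnma : ∀ u, nm (φ a u) = nm u := fun u => by
    rw [hnm, hnm, ← Equiv.prod_comp (Equiv.mulRight (⟨a, ha⟩ : stab v)) fun c : stab v => φ c u]
    exact Finset.prod_congr rfl fun c _ => by simp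
  obtain ⟨μ, hμ1, hμ⟩ : ∃ μ, μ ≠ 1 ∧ nm μ = 1 :=
    ⟨φ a w / w, by rwa [ne_eq, div_eq_one], by rw [map_div, hnma, div_self']⟩
  -- If `b` fixes `v * μ`, then `φ b v / v = μ / φ b μ`. The left side is fixed by `stab v`, as `A`
  -- is abelian, and the right side has norm `1`, so both are `1`.
  have hle : stab (v * μ) ≤ stab v ∧ ∀ b ∈ stab (v * μ), φ b μ = μ := by
    rw [SetLike.le_def, ← forall₂_and]
    intro b hb
    rw [hstab, map_mul] at hb
    have hd : φ b v / v = μ / φ b μ := by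
      rw [div_eq_div_iff_mul_eq_mul, hb, mul_comm]
    have h1 : φ b v / v = 1 := by
      refine hfix _ (fun c hc => ?_) ?_
      · rw [hstab] at hc
        rw [map_div, hcomm, hc]
      · rw [hd, map_div, hnmφ, hμ, map_one, div_one]
    exact ⟨(hstab _ _).2 (div_eq_one.1 h1), (div_eq_one.1 (hd ▸ h1)).symm⟩
  have hEq := Subgroup.eq_of_le_of_card_ge hle.1 (hv (v * μ))
  exact hμ1 (hfix μ (fun c hc => hle.2 c (hEq ▸ hc)) hμ)

/-- The regular orbit is taken in the dual group, which has the same order as `M`; the dual action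
is faithful because characters separate points. -/
theorem exists_linearChar_forall_comp_eq_imp_eq_one {A M : Type*} [CommGroup A] [CommGroup M]
    [Finite A] [Finite M] (ψ : A →* MulAut M) (hψ : Function.Injective ψ)
    (hco : (Nat.card A).Coprime (Nat.card M)) :
    ∃ lam : M →* ℂˣ, ∀ a, (∀ m, lam (ψ a m) = lam m) → a = 1 := by
  let φ : A →* MulAut (M →* ℂˣ) :=
    { toFun := fun a =>
        { toFun := fun f => f.comp (ψ a⁻¹).toMonoidHom
          invFun := fun f => f.comp (ψ a).toMonoidHom
          left_inv := fun f => by ext; simp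
          right_inv := fun f => by ext; simp
          map_mul' := fun f g => rfl }
      map_one' := by ext; simp
      map_mul' := fun a b => by ext; simp }
  have hφa : ∀ a f m, φ a f m = f (ψ a⁻¹ m) := fun _ _ _ => rfl
  have hcard := CommGroup.card_monoidHom_of_hasEnoughRootsOfUnity M ℂ
  have : Finite (M →* ℂˣ) := Nat.finite_of_card_ne_zero (hcard ▸ Nat.card_pos.ne')
  obtain ⟨lam, hlam⟩ := exists_forall_apply_eq_imp_eq_one φ (by
    rw [injective_iff_map_eq_one]
    intro a ha
    rw [← inv_eq_one]
    apply hψ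
    ext m
    rw [map_one, MulAut.one_apply]
    by_contra hne
    rw [← ne_eq, ← div_ne_one] at hne
    obtain ⟨f, hf⟩ := CommGroup.exists_apply_ne_one_of_hasEnoughRootsOfUnity M ℂ hne
    rw [map_div, ← hφa, ha] at hf
    simp at hf) (hcard ▸ hco)
  refine ⟨lam, fun a ha => hlam a (MonoidHom.ext fun m => ?_)⟩
  rw [hφa, ← ha, ← MulAut.mul_apply, ← map_mul, mul_inv_cancel, map_one, MulAut.one_apply]

/-! ### Construction of the vanishing character -/

theorem zeroExt_comap {G G' : Type*} [Group G] [Group G'] (f : G →* G') {T : Subgroup G'}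
    (lam : T →* ℂˣ) (g : G) :
    zeroExt (T.comap f) (lam.comp (f.subgroupComap T)) g = zeroExt T lam (f g) := by
  by_cases h : f g ∈ T
  · rw [zeroExt_of_mem lam h, zeroExt_of_mem _ (show g ∈ T.comap f from h)]; rfl
  · rw [zeroExt_of_notMem lam h, zeroExt_of_notMem _ (show g ∉ T.comap f from h)]

/-- There is a linear character of a subgroup, trivial on the intersection with `P`, whose
induced character is irreducible by Clifford's criterion and vanishes at some element of `P`
because this element has no conjugate in the subgroup. -/
def ExistsVanishingInduced {G : Type*} [Group G] (P : Subgroup G) : Prop :=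
  ∃ (T N : Subgroup G) (lam : T →* ℂˣ), N.Normal ∧ N ≤ T ∧
    (∀ g ∉ T, ∃ n : N, zeroExt T lam (g⁻¹ * n * g) ≠ zeroExt T lam n) ∧
    (∀ t : T, (t : G) ∈ P → lam t = 1) ∧ ∃ z ∈ P, ∀ x, x⁻¹ * z * x ∉ T

theorem ExistsVanishingInduced.comap {G G' : Type*} [Group G] [Group G'] {f : G →* G'}
    (hf : Function.Surjective f) {P : Subgroup G} (h : ExistsVanishingInduced (P.map f)) :
    ExistsVanishingInduced P := by
  obtain ⟨T, N, lam, hN, hNT, h1, h2, z, hz, h3⟩ := h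
  obtain ⟨z, hzP, rfl⟩ := hz
  refine ⟨T.comap f, N.comap f, lam.comp (f.subgroupComap T), hN.comap f,
    Subgroup.comap_mono hNT, fun g hg => ?_, fun t ht => ?_, z, hzP, fun x hx => ?_⟩
  · obtain ⟨⟨n, hn⟩, hne⟩ := h1 (f g) hg
    obtain ⟨n, rfl⟩ := hf n
    refine ⟨⟨n, hn⟩, ?_⟩
    simpa only [zeroExt_comap, map_mul, map_inv] using hne
  · exact h2 _ (Subgroup.mem_map_of_mem f ht)
  · exact h3 (f x) (by simpa using hx)

-- `T` is the inertia group of a character `lam` of `N` with trivial stabilizer in `Z`.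
open scoped IsMulCommutative in
theorem existsVanishingInduced_of_isComplement {G : Type*} [Group G] [Finite G]
    {N H P Z : Subgroup G} [hN : N.Normal] [IsMulCommutative N] [IsMulCommutative Z]
    (hinf : N ⊓ H = ⊥) (hsup : N ⊔ H = ⊤) (hPH : P ≤ H) (hZP : Z ≤ P) (hZ : Z ≠ ⊥)
    (hHZ : ∀ h ∈ H, ∀ z ∈ Z, h⁻¹ * z * h ∈ Z)
    (hfaith : ∀ z ∈ Z, (∀ n ∈ N, z * n * z⁻¹ = n) → z = 1)
    (hco : (Nat.card Z).Coprime (Nat.card N)) : ExistsVanishingInduced P := by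
  obtain ⟨lam, hlam⟩ := exists_linearChar_forall_comp_eq_imp_eq_one
    ((MulAut.conjNormal (H := N)).comp Z.subtype) (by
      rw [injective_iff_map_eq_one]
      intro z hz
      refine Subtype.ext (hfaith z z.2 fun n hn => ?_)
      have := congrArg (fun F : MulAut N => (F ⟨n, hn⟩ : G)) hz
      simpa using this) hco
  have hν : ∀ g : G, ∃ n : N, (n : G)⁻¹ * g ∈ H := by
    intro g
    obtain ⟨n, hn, h, hh, rfl⟩ := Subgroup.mem_sup_of_normal_left.1
      (hsup ▸ Subgroup.mem_top g : g ∈ N ⊔ H)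
    exact ⟨⟨n, hn⟩, by simpa using hh⟩
  choose ν hν using hν
  have huniq : ∀ (g : G) (n : N), (n : G)⁻¹ * g ∈ H → ν g = n := by
    intro g n hn
    have h1 : (n : G)⁻¹ * ν g ∈ N ⊓ H := by
      refine ⟨N.mul_mem (N.inv_mem n.2) (ν g).2, ?_⟩
      have := H.mul_mem hn (H.inv_mem (hν g))
      simpa [mul_assoc] using this
    rw [hinf, Subgroup.mem_bot, inv_mul_eq_one] at h1
    exact Subtype.ext h1.symm
  let T : Subgroup G :=
    { carrier := {g | ∀ n : N, lam (MulAut.conjNormal g n) = lam n}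
      one_mem' := by simp
      mul_mem' := fun {a b} ha hb n => by rw [map_mul, MulAut.mul_apply, ha, hb]
      inv_mem' := fun {a} ha n => by
        rw [← ha (MulAut.conjNormal a⁻¹ n), map_inv, MulAut.apply_inv_self] }
  have hT : ∀ g, g ∈ T ↔ ∀ n : N, lam (MulAut.conjNormal g n) = lam n := fun _ => Iff.rfl
  have hNT : N ≤ T := by
    intro m hm n
    have : MulAut.conjNormal m n = (⟨m, hm⟩ : N) * n * (⟨m, hm⟩ : N)⁻¹ := by
      ext; rfl
    rw [this, mul_comm, inv_mul_cancel_left]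
  -- The extension sends `n * h` to `lam n`; it is multiplicative because `T` fixes `lam`.
  let lam' : T →* ℂˣ := MonoidHom.mk' (fun t => lam (ν t)) fun a b => by
    have h1 : ν ((a * b : T) : G) = ν a * MulAut.conjNormal ((ν a : G)⁻¹ * a) (ν b) := by
      apply huniq
      have := mul_mem (hν a) (hν b)
      convert this using 1
      simp only [Subgroup.coe_mul, MulAut.conjNormal_apply]
      group
    rw [h1, map_mul, (hT _).1 (mul_mem (inv_mem (hNT (ν a).2)) a.2)]
  have hlam' : ∀ t : T, lam' t = lam (ν t) := fun _ => rfl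
  have hN' : ∀ n : N, zeroExt T lam' n = lam n := by
    intro n
    rw [zeroExt_of_mem lam' (hNT n.2), hlam', huniq _ n (by simp [one_mem])]
  refine ⟨T, N, lam', hN, hNT, fun g hg => ?_, fun t ht => ?_, ?_⟩
  · have hg' : g⁻¹ ∉ T := by simpa using hg
    rw [hT] at hg'
    push Not at hg'
    obtain ⟨n, hn⟩ := hg'
    refine ⟨n, ?_⟩
    have : g⁻¹ * n * g = (MulAut.conjNormal g⁻¹ n : N) := by simp
    rw [this, hN', hN', ne_eq, Units.val_inj]
    exact hn
  · rw [hlam', huniq t 1 (by simpa using hPH ht), map_one]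
  · obtain ⟨z, hz, hz1⟩ := Z.bot_or_exists_ne_one.resolve_left hZ
    refine ⟨z, hZP hz, fun x hx => ?_⟩
    -- As `N ≤ T`, the factor `n` can be removed from the conjugation, leaving an element of `Z ∩
    -- T`, which is trivial.
    obtain ⟨n, hn, h, hh, hxe⟩ := Subgroup.mem_sup_of_normal_left.1
      (hsup ▸ Subgroup.mem_top x⁻¹ : x⁻¹ ∈ N ⊔ H)
    have h1 : h * z * h⁻¹ ∈ T := by
      have := mul_mem (mul_mem (inv_mem (hNT hn)) hx) (hNT hn)
      convert this using 1
      rw [← inv_inv x, ← hxe]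
      group
    have h2 : h * z * h⁻¹ ∈ Z := by simpa using hHZ h⁻¹ (inv_mem hh) z hz
    have h3 := hlam ⟨_, h2⟩ ((hT _).1 h1)
    apply hz1
    simpa using congrArg Subtype.val h3

/-- A nontrivial finite solvable group has a nontrivial abelian normal subgroup. -/
theorem exists_normal_isMulCommutative_ne_bot (G : Type*) [Group G] [Group.IsSolvable G]
    [Nontrivial G] : ∃ N : Subgroup G, N.Normal ∧ IsMulCommutative N ∧ N ≠ ⊥ := by
  classical
  have hex : ∃ n, derivedSeries G n = ⊥ := (Group.isSolvable_def G).1 inferInstance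
  obtain ⟨k, hk⟩ : ∃ k, Nat.find hex = k + 1 := by
    refine Nat.exists_eq_succ_of_ne_zero fun h0 => ?_
    have := Nat.find_spec hex
    rw [h0, derivedSeries_zero] at this
    exact top_ne_bot this
  refine ⟨derivedSeries G k, inferInstance, ?_, Nat.find_min hex (by omega)⟩
  have h := Nat.find_spec hex
  rw [hk, derivedSeries_succ, Subgroup.commutator_eq_bot_iff_le_centralizer] at h
  refine ⟨⟨fun a b => Subtype.ext ?_⟩⟩
  exact h b.2 a a.2

/-- Induction on `|G|`. A quotient in which the image of `P` is still not normal supplies the data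
by inflation; otherwise every nontrivial normal subgroup is supplemented by `N_G(P)`, and none lies
inside it. -/
theorem existsVanishingInduced_of_not_normal {p : ℕ} [Fact p.Prime] (k : ℕ) :
    ∀ {G : Type*} [Group G] [Finite G] [Group.IsSolvable G], Nat.card G = k →
      ∀ P : Sylow p G, ¬ (P : Subgroup G).Normal → ExistsVanishingInduced (P : Subgroup G) := by
  induction k using Nat.strong_induction_on with
  | _ k ih =>
  intro G _ _ _ hk P hP
  by_cases hq : ∃ (M : Subgroup G) (_ : M.Normal), M ≠ ⊥ ∧
      ¬ ((P : Subgroup G).map (QuotientGroup.mk' M)).Normal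
  · obtain ⟨M, _, hM, hMP⟩ := hq
    have hsurj := QuotientGroup.mk'_surjective M
    have := Group.isSolvable_of_surjective hsurj
    refine ExistsVanishingInduced.comap hsurj ?_
    exact ih (Nat.card (G ⧸ M)) (by
      rw [← hk, M.card_eq_card_quotient_mul_card_subgroup]
      exact lt_mul_of_one_lt_right Nat.card_pos (M.one_lt_card_iff_ne_bot.2 hM)) rfl
      (P.mapSurjective hsurj) hMP
  push Not at hq
  have hfrat : ∀ (M : Subgroup G) [M.Normal], M ≠ ⊥ → M ⊔ Subgroup.normalizer ((P : Subgroup G) : Set G) = ⊤ := by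
    intro M _ hM
    have h1 := hq M inferInstance hM
    have h2 := h1.comap (QuotientGroup.mk' M)
    rw [Subgroup.comap_map_eq, QuotientGroup.ker_mk'] at h2
    have h3 : Subgroup.normalizer ((P : Subgroup G) : Set G) ⊔ ((P : Subgroup G) ⊔ M) = ⊤ :=
      P.normalizer_sup_eq_top' le_sup_left
    rw [← sup_assoc, sup_eq_left.2 Subgroup.le_normalizer, sup_comm] at h3
    exact h3
  have hnle : ∀ (M : Subgroup G) [M.Normal], M ≤ Subgroup.normalizer ((P : Subgroup G) : Set G) → M = ⊥ := by
    intro M _ hM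
    by_contra h
    have := hfrat M h
    rw [sup_eq_right.2 hM, Subgroup.normalizer_eq_top_iff] at this
    exact hP this
  have hPbot : (P : Subgroup G) ≠ ⊥ := fun h => hP (h ▸ inferInstance)
  have : Nontrivial G := by
    by_contra h
    rw [not_nontrivial_iff_subsingleton] at h
    exact hPbot (Subsingleton.elim _ _)
  obtain ⟨N, hN, hNc, hN1⟩ := exists_normal_isMulCommutative_ne_bot G
  have hcommN : ∀ a ∈ N, ∀ b ∈ N, a * b = b * a := fun a ha b hb =>
    congrArg Subtype.val (hNc.is_comm.comm (⟨a, ha⟩ : N) ⟨b, hb⟩)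
  -- A subgroup normalized by the normalizer of `P` and centralized by `N` is normal.
  have hnormal : ∀ M : Subgroup G, (∀ h ∈ Subgroup.normalizer ((P : Subgroup G) : Set G), ∀ m ∈ M, h * m * h⁻¹ ∈ M) →
      (∀ n ∈ N, ∀ m ∈ M, n * m = m * n) → M.Normal := by
    intro M h1 h2
    refine ⟨fun m hm g => ?_⟩
    obtain ⟨n, hn, h, hh, rfl⟩ := Subgroup.mem_sup_of_normal_left.1
      (hfrat N hN1 ▸ Subgroup.mem_top g : g ∈ N ⊔ Subgroup.normalizer ((P : Subgroup G) : Set G))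
    have h3 := h1 h hh m hm
    have h4 : n * h * m * (n * h)⁻¹ = h * m * h⁻¹ := by
      calc _ = n * (h * m * h⁻¹) * n⁻¹ := by group
        _ = _ := by rw [h2 n hn _ h3]; group
    rwa [h4]
  let Z : Subgroup G := (Subgroup.center P).map (P : Subgroup G).subtype
  have hZP : Z ≤ P := Subgroup.map_subtype_le _
  have hZmem : ∀ z, z ∈ Z ↔ z ∈ P ∧ ∀ x ∈ P, x * z = z * x := by
    intro z
    simp only [Z, Subgroup.mem_map, Subgroup.mem_center_iff]
    constructor
    · rintro ⟨z, hz, rfl⟩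
      exact ⟨z.2, fun x hx => congrArg Subtype.val (hz ⟨x, hx⟩)⟩
    · rintro ⟨hz, h⟩
      exact ⟨⟨z, hz⟩, fun x => Subtype.ext (h x x.2), rfl⟩
  have hHZ : ∀ h ∈ Subgroup.normalizer ((P : Subgroup G) : Set G), ∀ z ∈ Z, h * z * h⁻¹ ∈ Z := by
    intro h hh z hz
    rw [hZmem] at hz ⊢
    refine ⟨(Subgroup.mem_normalizer_iff.1 hh z).1 hz.1, fun x hx => ?_⟩
    have hx' : h⁻¹ * x * h ∈ P := (Subgroup.mem_normalizer_iff''.1 hh x).1 hx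
    have := hz.2 _ hx'
    calc x * (h * z * h⁻¹) = h * (h⁻¹ * x * h * z) * h⁻¹ := by group
      _ = _ := by rw [this]; group
  have : IsMulCommutative Z := ⟨⟨fun a b => Subtype.ext
    (((hZmem b).1 b.2).2 a (hZP a.2))⟩⟩
  refine existsVanishingInduced_of_isComplement (N := N) (H := Subgroup.normalizer ((P : Subgroup G) : Set G))
    (Z := Z) ?_ (hfrat N hN1) Subgroup.le_normalizer hZP ?_ ?_ ?_ ?_
  · have : (N ⊓ Subgroup.normalizer ((P : Subgroup G) : Set G)).Normal :=
      hnormal _ (fun h hh m hm => Subgroup.mem_inf.2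
        ⟨hN.conj_mem m hm.1 h, mul_mem (mul_mem hh hm.2) (inv_mem hh)⟩)
        fun n hn m hm => hcommN n hn m hm.1
    exact hnle _ inf_le_right
  · have : Nontrivial P := (Subgroup.nontrivial_iff_ne_bot _).2 hPbot
    have := P.2.center_nontrivial
    rw [ne_eq, Subgroup.map_eq_bot_iff_of_injective _ (Subgroup.subtype_injective _)]
    exact (Subgroup.nontrivial_iff_ne_bot _).1 this
  · intro h hh z hz
    simpa using hHZ h⁻¹ (inv_mem hh) z hz
  · intro z hz hfix
    -- The kernel of the action of `Z` on `N` is normal in `G` and lies in `P`, hence is trivial.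
    let C : Subgroup G := Z ⊓ Subgroup.centralizer N
    have : C.Normal := by
      refine hnormal C (fun h hh m hm => Subgroup.mem_inf.2 ⟨hHZ h hh m hm.1, ?_⟩) fun n hn m hm =>
        Subgroup.mem_centralizer_iff.1 hm.2 n hn
      rw [Subgroup.mem_centralizer_iff]
      intro n hn
      have h1 := Subgroup.mem_centralizer_iff.1 hm.2 (h⁻¹ * n * h)
        (by simpa using hN.conj_mem n hn h⁻¹)
      calc n * (h * m * h⁻¹) = h * (h⁻¹ * n * h * m) * h⁻¹ := by group
        _ = _ := by rw [h1]; group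
    have hC := hnle C (inf_le_left.trans (hZP.trans Subgroup.le_normalizer))
    have : z ∈ C := ⟨hz, Subgroup.mem_centralizer_iff.2 fun n hn => by
      have := hfix n hn
      rw [mul_inv_eq_iff_eq_mul] at this
      exact this.symm⟩
    rwa [hC, Subgroup.mem_bot] at this
  · obtain ⟨m, hm⟩ := IsPGroup.iff_card.1 (P.2.to_le hZP)
    rw [hm]
    refine Nat.Coprime.pow_left _ ((Nat.Prime.coprime_iff_not_dvd Fact.out).2 fun hdvd => ?_)
    obtain ⟨n, hn⟩ := exists_prime_orderOf_dvd_card' p hdvd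
    -- If `p` divided `|N|`, this `p`-torsion would be a nontrivial normal `p`-subgroup of `G`,
    -- hence contained in `P`.
    let M : Subgroup G :=
      { carrier := {n | n ∈ N ∧ n ^ p = 1}
        one_mem' := ⟨one_mem _, one_pow _⟩
        mul_mem' := fun {a b} ha hb => ⟨mul_mem ha.1 hb.1, by
          rw [Commute.mul_pow (hcommN a ha.1 b hb.1), ha.2, hb.2, one_mul]⟩
        inv_mem' := fun {a} ha => ⟨inv_mem ha.1, by rw [inv_pow, ha.2, inv_one]⟩ }
    have : M.Normal := ⟨fun m hm g => ⟨hN.conj_mem m hm.1 g, by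
      rw [conj_pow, hm.2, mul_one, mul_inv_cancel]⟩⟩
    have hMp : IsPGroup p M := fun m => ⟨1, Subtype.ext (by simpa using m.2.2)⟩
    have hM := hnle M ((hMp.le_sylow_of_normal P).trans Subgroup.le_normalizer)
    have hnM : (n : G) ∈ M := ⟨n.2, by
      rw [← Subgroup.coe_pow, ← hn, pow_orderOf_eq_one, Subgroup.coe_one]⟩
    rw [hM, Subgroup.mem_bot] at hnM
    rw [Subtype.ext (a1 := n) (a2 := 1) hnM, orderOf_one] at hn
    exact (Fact.out : p.Prime).one_lt.ne hn

end MonomialChar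

/-! ### The equivalence -/

theorem theoremA {G : Type*} [Group G] [Finite G] [Group.IsSolvable G] (p : ℕ) [Fact p.Prime]
    (P : Sylow p G) :
    List.TFAE [
      (P : Subgroup G).Normal,
      ∀ χ ∈ MonomialChar.irrMonomialOverPrincipal (P : Subgroup G),
        ∃ d : ℕ, χ 1 = (d : ℂ) ∧ ¬ p ∣ d,
      ∀ χ ∈ MonomialChar.irrMonomialOverPrincipal (P : Subgroup G),
        ∀ x ∈ P, χ x ≠ 0] := by
  have hwit : ¬ (P : Subgroup G).Normal →
      ∃ T : Subgroup G, ∃ lam : T →* ℂˣ,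
        MonomialChar.inducedChar T lam ∈ MonomialChar.irrMonomialOverPrincipal (P : Subgroup G) ∧
        ∃ z ∈ P, ∀ x, x⁻¹ * z * x ∉ T := by
    intro hP
    obtain ⟨T, N, lam, hN, hNT, h1, h2, h3⟩ :=
      MonomialChar.existsVanishingInduced_of_not_normal _ rfl P hP
    exact ⟨T, lam, ⟨MonomialChar.isIrr_inducedChar lam N hNT h1, ⟨T, lam, rfl⟩,
      MonomialChar.liesOver_inducedChar lam P h2⟩, h3⟩
  tfae_have 1 → 2 := by
    rintro hP χ ⟨hirr, ⟨T, lam, rfl⟩, hover⟩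
    refine ⟨T.index, MonomialChar.inducedChar_one lam, fun hdvd => P.not_dvd_index (hdvd.trans ?_)⟩
    refine Subgroup.index_dvd_of_le fun x hx => ?_
    have := (MonomialChar.apply_eq_apply_one_of_liesOver (P : Subgroup G) hirr hover).2 x hx
    simpa using MonomialChar.conj_mem_of_inducedChar_eq lam this 1
  tfae_have 1 → 3 := by
    rintro hP χ ⟨hirr, -, hover⟩ x hx
    obtain ⟨h1, h2⟩ :=
      MonomialChar.apply_eq_apply_one_of_liesOver (P : Subgroup G) hirr hover
    rwa [h2 x hx]
  tfae_have 2 → 1 := by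
    intro h
    by_contra hP
    obtain ⟨T, lam, hmem, z, hz, hzT⟩ := hwit hP
    obtain ⟨d, hd, hpd⟩ := h _ hmem
    rw [MonomialChar.inducedChar_one, Nat.cast_inj] at hd
    subst hd
    -- As `p ∤ |G : T|`, a Sylow subgroup of `T` is Sylow in `G`, hence conjugate to `P`, so `T`
    -- contains a conjugate of `z`.
    obtain ⟨Q⟩ : Nonempty (Sylow p T) := inferInstance
    have hQ : IsPGroup p ((Q : Subgroup T).map T.subtype) := Q.2.map _
    have hidx : ¬ p ∣ ((Q : Subgroup T).map T.subtype).index := by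
      rw [Subgroup.index_map_subtype, (Fact.out : p.Prime).dvd_mul, not_or]
      exact ⟨Q.not_dvd_index, hpd⟩
    obtain ⟨g, hg⟩ := MulAction.exists_smul_eq G P (hQ.toSylow hidx)
    have h1 : g * z * g⁻¹ ∈ (g • P : Sylow p G) :=
      Subgroup.smul_mem_pointwise_smul z (MulAut.conj g) (P : Subgroup G) hz
    rw [hg, IsPGroup.mem_toSylow] at h1
    exact hzT g⁻¹ (by simpa using Subgroup.map_subtype_le _ h1)
  tfae_have 3 → 1 := by
    intro h
    by_contra hP
    obtain ⟨T, lam, hmem, z, hz, hzT⟩ := hwit hP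
    exact h _ hmem z hz (MonomialChar.inducedChar_eq_zero lam hzT)
  tfae_finish
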